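/- Let $C$ be a unital abelian C$^*$-algebra with spectrum (character space) $\Delta$. A Banach $C$-bimodule $X$ is called \emph{central} if $cx=xc$ for all $c\in C$, $x\in X$, and \emph{representable} if there exist Hilbert spaces $\mathcal H,\mathcal K$ with $*$-representations $\pi:C\to B(\mathcal H)$, $\sigma:C\to B(\mathcal K)$ and a linear isometry $\Phi:X\to B(\mathcal K,\mathcal H)$ such that $\Phi(cx)=\pi(c)\Phi(x)$ and $\Phi(xc)=\Phi(x)\sigma(c)$ for all $c\in C$, $x\in X$. Let $X,Y$ be central representable (unital) Banach $C$-bimodules. For $t\in\Delta$ let $C_t=\ker t$, let $X(t)=X/[C_tX]$ be the quotient Banach space by the closed linear span $[C_tX]$ of $\{cx: c\in C_t,\ x\in X\}$, and denote by $x(t)$ the coset of $x\in X$ in $X(t)$; similarly for $Y$. Let $\stackrel{\gamma}{\otimes}$ denote the (completed) projective tensor product of Banach spaces, and let $X\stackrel{\gamma}{\otimes}_C Y$ be the quotient of $X\stackrel{\gamma}{\otimes}Y$ by the closed linear span of all elements $xc\otimes y-x\otimes cy$ ($x\in X$, $y\in Y$, $c\in C$), with the quotient norm; write $x\otimes_C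 y$ for the class of $x\otimes y$. It is a Banach $C$-bimodule with $c(x\otimes_C y)=cx\otimes_C y$ and $(x\otimes_C y)c=x\otimes_C yc$. Let $\oplus_{t\in\Delta}$ denote the $\ell^\infty$-direct sum (all bounded families, with the supremum norm). Then the natural contraction $$\kappa: X\stackrel{\gamma}{\otimes}_C Y\to\oplus_{t\in\Delta}\bigl(X(t)\stackrel{\gamma}{\otimes}Y(t)\bigr),\qquad \kappa(x\otimes_C y)=(x(t)\otimes y(t))_{t\in\Delta},$$ is isometric. Consequently $X\stackrel{\gamma}{\otimes}_C Y$ is a representable $C$-bimodule. -/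

import Mathlib

open scoped TensorProduct ENNReal

universe uC uX uY w₁ w₂

set_option linter.unusedSectionVars false

noncomputable section

namespace CentralBimodule

/-! ### Representable bimodules -/

/-- A Banach `A,B`-bimodule `X` (left action of `A`, right action of `B` written as an action of
`Bᵐᵒᵖ`) is representable if there are Hilbert spaces `H`, `K`, `*`-representations `π` of `A` on `H`
and `σ` of `B` on `K`, and an isometric `A,B`-bimodule homomorphism `X → B(K, H)`. -/
def IsRepresentable.{w, a, b, x} (A : Type a) (B : Type b) [CStarAlgebra A] [CStarAlgebra B]
    (X : Type x) [NormedAddCommGroup X] [NormedSpace ℂ X] [Module A X] [Module Bᵐᵒᵖ X] : Prop :=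
  ∃ (H : Type w) (_ : NormedAddCommGroup H) (_ : InnerProductSpace ℂ H) (_ : CompleteSpace H)
    (K : Type w) (_ : NormedAddCommGroup K) (_ : InnerProductSpace ℂ K) (_ : CompleteSpace K)
    (π : A →⋆ₐ[ℂ] (H →L[ℂ] H)) (σ : B →⋆ₐ[ℂ] (K →L[ℂ] K)) (Φ : X →ₗᵢ[ℂ] (K →L[ℂ] H)),
    (∀ (a : A) (x : X), Φ (a • x) = π a ∘L Φ x) ∧
      ∀ (b : B) (x : X), Φ (MulOpposite.op b • x) = Φ x ∘L σ b

/-! ### The projective tensor product of Banach spaces -/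

section Projective

variable (X Y : Type*) [SeminormedAddCommGroup X] [NormedSpace ℂ X]
  [SeminormedAddCommGroup Y] [NormedSpace ℂ Y]

/-- The algebraic tensor product, as a carrier for the projective norm. -/
def AlgTensor : Type _ := X ⊗[ℂ] Y

instance : AddCommGroup (AlgTensor X Y) := inferInstanceAs (AddCommGroup (X ⊗[ℂ] Y))

instance : Module ℂ (AlgTensor X Y) := inferInstanceAs (Module ℂ (X ⊗[ℂ] Y))

variable {X Y}

/-- The numbers `∑ ‖xᵢ‖ ‖yᵢ‖`, over all representations `w = ∑ xᵢ ⊗ yᵢ`. -/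
def projCosts (w : X ⊗[ℂ] Y) : Set ℝ :=
  {r | ∃ (n : ℕ) (x : Fin n → X) (y : Fin n → Y),
    w = ∑ i, x i ⊗ₜ[ℂ] y i ∧ r = ∑ i, ‖x i‖ * ‖y i‖}

/-- The projective norm `γ(w) = inf {∑ ‖xᵢ‖ ‖yᵢ‖ : w = ∑ xᵢ ⊗ yᵢ}`. -/
def projNorm (w : X ⊗[ℂ] Y) : ℝ := sInf (projCosts w)

theorem projCosts_nonneg {w : X ⊗[ℂ] Y} {r : ℝ} (hr : r ∈ projCosts w) : 0 ≤ r := by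
  obtain ⟨n, x, y, -, rfl⟩ := hr
  positivity

theorem projCosts_bddBelow (w : X ⊗[ℂ] Y) : BddBelow (projCosts w) :=
  ⟨0, fun _ hr => projCosts_nonneg hr⟩

theorem projCosts_add {v w : X ⊗[ℂ] Y} {r s : ℝ} (hr : r ∈ projCosts v) (hs : s ∈ projCosts w) :
    r + s ∈ projCosts (v + w) := by
  obtain ⟨n, x, y, rfl, rfl⟩ := hr
  obtain ⟨m, x', y', rfl, rfl⟩ := hs
  refine ⟨n + m, Fin.append x x', Fin.append y y', ?_, ?_⟩ <;> simp [Fin.sum_univ_add]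

theorem projCosts_tmul (x : X) (y : Y) : ‖x‖ * ‖y‖ ∈ projCosts (x ⊗ₜ[ℂ] y) :=
  ⟨1, fun _ => x, fun _ => y, by simp, by simp⟩

theorem projCosts_zero : (0 : ℝ) ∈ projCosts (0 : X ⊗[ℂ] Y) :=
  ⟨0, Fin.elim0, Fin.elim0, by simp, by simp⟩

theorem projCosts_nonempty (w : X ⊗[ℂ] Y) : (projCosts w).Nonempty := by
  induction w with
  | zero => exact ⟨0, projCosts_zero⟩
  | tmul x y => exact ⟨_, projCosts_tmul x y⟩
  | add v w hv hw =>
    obtain ⟨r, hr⟩ := hv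
    obtain ⟨s, hs⟩ := hw
    exact ⟨r + s, projCosts_add hr hs⟩

theorem projNorm_le {w : X ⊗[ℂ] Y} {r : ℝ} (hr : r ∈ projCosts w) : projNorm w ≤ r :=
  csInf_le (projCosts_bddBelow w) hr

theorem projNorm_nonneg (w : X ⊗[ℂ] Y) : 0 ≤ projNorm w :=
  Real.sInf_nonneg fun _ hr => projCosts_nonneg hr

theorem projNorm_zero : projNorm (0 : X ⊗[ℂ] Y) = 0 :=
  le_antisymm (projNorm_le projCosts_zero) (projNorm_nonneg _)

theorem projNorm_add_le (v w : X ⊗[ℂ] Y) : projNorm (v + w) ≤ projNorm v + projNorm w := by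
  refine le_of_forall_pos_le_add fun ε hε => ?_
  obtain ⟨r, hr, hr'⟩ := exists_lt_of_csInf_lt (projCosts_nonempty v)
    (show sInf (projCosts v) < projNorm v + ε / 2 by unfold projNorm; linarith)
  obtain ⟨s, hs, hs'⟩ := exists_lt_of_csInf_lt (projCosts_nonempty w)
    (show sInf (projCosts w) < projNorm w + ε / 2 by unfold projNorm; linarith)
  linarith [projNorm_le (projCosts_add hr hs)]

variable {X' Y' : Type*} [SeminormedAddCommGroup X'] [NormedSpace ℂ X']
  [SeminormedAddCommGroup Y'] [NormedSpace ℂ Y']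

theorem projNorm_map_le (f : X →L[ℂ] X') (g : Y →L[ℂ] Y') (w : X ⊗[ℂ] Y) :
    projNorm (TensorProduct.map f.toLinearMap g.toLinearMap w) ≤ ‖f‖ * ‖g‖ * projNorm w := by
  have key : ∀ r ∈ projCosts w,
      projNorm (TensorProduct.map f.toLinearMap g.toLinearMap w) ≤ ‖f‖ * ‖g‖ * r := by
    rintro r ⟨n, x, y, rfl, rfl⟩
    refine (projNorm_le ⟨n, fun i => f (x i), fun i => g (y i), by simp [map_sum], rfl⟩).trans ?_
    rw [Finset.mul_sum]
    refine Finset.sum_le_sum fun i _ => ?_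
    calc ‖f (x i)‖ * ‖g (y i)‖ ≤ (‖f‖ * ‖x i‖) * (‖g‖ * ‖y i‖) :=
          mul_le_mul (f.le_opNorm _) (g.le_opNorm _) (norm_nonneg _) (by positivity)
      _ = ‖f‖ * ‖g‖ * (‖x i‖ * ‖y i‖) := by ring
  rw [projNorm, projNorm, ← smul_eq_mul (‖f‖ * ‖g‖), ← Real.sInf_smul_of_nonneg (by positivity)]
  refine le_csInf ((projCosts_nonempty w).smul_set) ?_
  rintro _ ⟨r, hr, rfl⟩
  exact key r hr

theorem projNorm_smul_le (c : ℂ) (w : X ⊗[ℂ] Y) : projNorm (c • w) ≤ ‖c‖ * projNorm w := by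
  have key : ∀ r ∈ projCosts w, projNorm (c • w) ≤ ‖c‖ * r := by
    rintro r ⟨n, x, y, rfl, rfl⟩
    exact projNorm_le ⟨n, fun i => c • x i, y, by simp [Finset.smul_sum, TensorProduct.smul_tmul'],
      by simp [Finset.mul_sum, norm_smul, mul_assoc]⟩
  rw [projNorm, projNorm, ← smul_eq_mul ‖c‖, ← Real.sInf_smul_of_nonneg (by positivity)]
  refine le_csInf ((projCosts_nonempty w).smul_set) ?_
  rintro _ ⟨r, hr, rfl⟩
  exact key r hr

variable (X Y)

/-- The projective norm as a seminorm on the algebraic tensor product. -/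
def projSeminorm : Seminorm ℂ (AlgTensor X Y) :=
  Seminorm.ofSMulLE (fun w => projNorm (X := X) (Y := Y) w) projNorm_zero projNorm_add_le
    projNorm_smul_le

instance : SeminormedAddCommGroup (AlgTensor X Y) :=
  AddGroupSeminorm.toSeminormedAddCommGroup (projSeminorm X Y).toAddGroupSeminorm

instance : NormedSpace ℂ (AlgTensor X Y) := ⟨projNorm_smul_le (X := X) (Y := Y)⟩

/-- The Banach space projective tensor product: the completion of the algebraic tensor product
in the projective norm. -/
abbrev ProjTensor : Type _ := UniformSpace.Completion (AlgTensor X Y)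

variable {X Y}

/-- The elementary tensor `x ⊗ y` in the projective tensor product. -/
def ptmul (x : X) (y : Y) : ProjTensor X Y :=
  ((show AlgTensor X Y from x ⊗ₜ[ℂ] y : AlgTensor X Y) : UniformSpace.Completion (AlgTensor X Y))

/-- The map `f ⊗ g` on algebraic tensor products, bounded for the projective norms. -/
def algMap (f : X →L[ℂ] X') (g : Y →L[ℂ] Y') : AlgTensor X Y →L[ℂ] AlgTensor X' Y' :=
  LinearMap.mkContinuous (TensorProduct.map f.toLinearMap g.toLinearMap :
    X ⊗[ℂ] Y →ₗ[ℂ] X' ⊗[ℂ] Y') (‖f‖ * ‖g‖) (projNorm_map_le f g)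

/-- The map `f ⊗ g` on projective tensor products. -/
def ptmap (f : X →L[ℂ] X') (g : Y →L[ℂ] Y') : ProjTensor X Y →L[ℂ] ProjTensor X' Y' :=
  (algMap f g).completion

theorem ptmap_ptmul (f : X →L[ℂ] X') (g : Y →L[ℂ] Y') (x : X) (y : Y) :
    ptmap f g (ptmul x y) = ptmul (f x) (g y) := by
  unfold ptmap ptmul
  rw [ContinuousLinearMap.completion_apply_coe]
  rfl

theorem norm_ptmap_le (f : X →L[ℂ] X') (g : Y →L[ℂ] Y') (w : ProjTensor X Y) :
    ‖ptmap f g w‖ ≤ ‖f‖ * ‖g‖ * ‖w‖ := by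
  induction w using UniformSpace.Completion.induction_on with
  | hp => exact isClosed_le (by fun_prop) (by fun_prop)
  | ih w =>
    unfold ptmap
    rw [ContinuousLinearMap.completion_apply_coe, UniformSpace.Completion.norm_coe,
      UniformSpace.Completion.norm_coe]
    exact projNorm_map_le f g w

theorem ptmul_add (x : X) (y y' : Y) : ptmul x (y + y') = ptmul x y + ptmul x y' := by
  unfold ptmul
  rw [← UniformSpace.Completion.coe_add]
  exact congrArg _ (TensorProduct.tmul_add x y y')

theorem add_ptmul (x x' : X) (y : Y) : ptmul (x + x') y = ptmul x y + ptmul x' y := by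
  unfold ptmul
  rw [← UniformSpace.Completion.coe_add]
  exact congrArg _ (TensorProduct.add_tmul x x' y)

theorem smul_ptmul (c : ℂ) (x : X) (y : Y) : ptmul (c • x) y = c • ptmul x y := by
  unfold ptmul
  rw [← UniformSpace.Completion.coe_smul]
  rfl

theorem ptmul_smul (c : ℂ) (x : X) (y : Y) : ptmul x (c • y) = c • ptmul x y := by
  unfold ptmul
  rw [← UniformSpace.Completion.coe_smul]
  exact congrArg _ (TensorProduct.tmul_smul c x y)

theorem projTensor_ext {E : Type*} [AddCommGroup E] [Module ℂ E] [TopologicalSpace E] [T2Space E]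
    {f g : ProjTensor X Y →L[ℂ] E} (h : ∀ x y, f (ptmul x y) = g (ptmul x y)) : f = g := by
  have h1 : (f ∘L UniformSpace.Completion.toComplL).toLinearMap =
      (g ∘L (UniformSpace.Completion.toComplL (𝕜 := ℂ) (E := AlgTensor X Y))).toLinearMap :=
    TensorProduct.ext' (R := ℂ) (M := X) (N := Y) h
  ext w
  induction w using UniformSpace.Completion.induction_on with
  | hp => exact isClosed_eq (by fun_prop) (by fun_prop)
  | ih w => exact LinearMap.congr_fun h1 w

end Projective

/-! ### Fibres over the spectrum -/

section Fiber

variable (C : Type*) [CommCStarAlgebra C] (X : Type*) [NormedAddCommGroup X] [NormedSpace ℂ X]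
  [Module C X] (t : WeakDual.characterSpace ℂ C)

/-- The closed linear span `[C_t X]`, where `C_t` is the kernel of the character `t`. -/
def fiberKer : Submodule ℂ X :=
  (Submodule.span ℂ {v : X | ∃ (c : C) (x : X), t c = 0 ∧ v = c • x}).topologicalClosure

instance : IsClosed (fiberKer C X t : Set X) := Submodule.isClosed_topologicalClosure _

/-- The fibre `X(t) = X / [C_t X]` with the quotient norm. -/
abbrev Fiber : Type _ := X ⧸ fiberKer C X t

variable {X}

/-- The coset `x(t)` of `x` in `X(t)`. -/
def toFiber : X →L[ℂ] Fiber C X t := (fiberKer C X t).mkQL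

theorem norm_toFiber_le : ‖toFiber C (X := X) t‖ ≤ 1 :=
  ContinuousLinearMap.opNorm_le_bound _ zero_le_one fun x => by
    rw [one_mul]
    exact Submodule.Quotient.norm_mk_le (fiberKer C X t) x

variable {C}

theorem toFiber_smul [IsScalarTower ℂ C X] (c : C) (x : X) :
    toFiber C t (c • x) = t c • toFiber C t x := by
  rw [← map_smul, ← sub_eq_zero, ← map_sub]
  refine (Submodule.Quotient.mk_eq_zero _).2 (Submodule.le_topologicalClosure _
    (Submodule.subset_span ⟨c - algebraMap ℂ C (t c), x, ?_, ?_⟩))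
  · rw [map_sub, AlgHomClass.commutes]
    exact sub_self _
  · rw [sub_smul, algebraMap_smul]

end Fiber

/-! ### The projective tensor product of Banach modules -/

section Balanced

variable (C : Type*) [CommCStarAlgebra C] (X Y : Type*)
  [NormedAddCommGroup X] [NormedSpace ℂ X] [Module Cᵐᵒᵖ X]
  [NormedAddCommGroup Y] [NormedSpace ℂ Y] [Module C Y]

/-- The closed linear span in the projective tensor product of all `xc ⊗ y - x ⊗ cy`. -/
def balancedKer : Submodule ℂ (ProjTensor X Y) :=
  (Submodule.span ℂ {v | ∃ (x : X) (c : C) (y : Y),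
    v = ptmul (MulOpposite.op c • x) y - ptmul x (c • y)}).topologicalClosure

instance : IsClosed (balancedKer C X Y : Set (ProjTensor X Y)) :=
  Submodule.isClosed_topologicalClosure _

/-- The Banach module projective tensor product over `C`: the quotient of the Banach space
projective tensor product by the closed span of all `xc ⊗ y - x ⊗ cy`, with the quotient norm. -/
def ModTensor : Type _ :=
  ProjTensor X Y ⧸ balancedKer C X Y

instance : NormedAddCommGroup (ModTensor C X Y) :=
  inferInstanceAs (NormedAddCommGroup (ProjTensor X Y ⧸ balancedKer C X Y))

instance : NormedSpace ℂ (ModTensor C X Y) :=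
  inferInstanceAs (NormedSpace ℂ (ProjTensor X Y ⧸ balancedKer C X Y))

instance : CompleteSpace (ModTensor C X Y) :=
  inferInstanceAs (CompleteSpace (ProjTensor X Y ⧸ balancedKer C X Y))

/-- The quotient map onto the module tensor product. -/
def modMk : ProjTensor X Y →L[ℂ] ModTensor C X Y := (balancedKer C X Y).mkQL

variable {X Y}

/-- The elementary tensor `x ⊗_C y`. -/
def mtmul (x : X) (y : Y) : ModTensor C X Y := modMk C X Y (ptmul x y)

theorem mtmul_balanced (x : X) (c : C) (y : Y) :
    mtmul C (MulOpposite.op c • x) y = mtmul C x (c • y) := by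
  unfold mtmul
  rw [← sub_eq_zero, ← map_sub]
  exact (Submodule.Quotient.mk_eq_zero _).2
    (Submodule.le_topologicalClosure _ (Submodule.subset_span ⟨x, c, y, rfl⟩))

variable {C}

theorem modTensor_ext {E : Type*} [AddCommGroup E] [Module ℂ E] [TopologicalSpace E] [T2Space E]
    {f g : ModTensor C X Y →L[ℂ] E} (h : ∀ x y, f (mtmul C x y) = g (mtmul C x y)) : f = g := by
  have h1 : f ∘L modMk C X Y = g ∘L modMk C X Y := projTensor_ext h
  ext z
  obtain ⟨w, rfl⟩ := Submodule.mkQ_surjective (balancedKer C X Y) z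
  exact DFunLike.congr_fun h1 w

variable {E : Type*} [NormedAddCommGroup E] [NormedSpace ℂ E]

theorem balancedKer_le_ker (f : ProjTensor X Y →L[ℂ] E)
    (hf : ∀ x (c : C) y, f (ptmul (MulOpposite.op c • x) y) = f (ptmul x (c • y))) :
    balancedKer C X Y ≤ f.ker := by
  refine Submodule.topologicalClosure_minimal _ (Submodule.span_le.2 ?_) f.isClosed_ker
  rintro _ ⟨x, c, y, rfl⟩
  simpa [sub_eq_zero] using hf x c y

/-- A bounded linear map that is `C`-balanced on elementary tensors descends to the module
tensor product. -/
def modLift (f : ProjTensor X Y →L[ℂ] E)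
    (hf : ∀ x (c : C) y, f (ptmul (MulOpposite.op c • x) y) = f (ptmul x (c • y))) :
    ModTensor C X Y →L[ℂ] E :=
  (balancedKer C X Y).liftQL f (balancedKer_le_ker f hf)

theorem modLift_mtmul (f : ProjTensor X Y →L[ℂ] E)
    (hf : ∀ x (c : C) y, f (ptmul (MulOpposite.op c • x) y) = f (ptmul x (c • y))) (x : X) (y : Y) :
    modLift f hf (mtmul C x y) = f (ptmul x y) := rfl

theorem norm_modLift_le (f : ProjTensor X Y →L[ℂ] E)
    (hf : ∀ x (c : C) y, f (ptmul (MulOpposite.op c • x) y) = f (ptmul x (c • y))) {M : ℝ}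
    (hM0 : 0 ≤ M) (hM : ∀ w, ‖f w‖ ≤ M * ‖w‖) (z : ModTensor C X Y) :
    ‖modLift f hf z‖ ≤ M * ‖z‖ := by
  refine le_of_forall_pos_le_add fun ε hε => ?_
  obtain ⟨w, rfl, hw⟩ := Submodule.Quotient.norm_mk_lt (S := balancedKer C X Y) z
    (show 0 < ε / (M + 1) by positivity)
  refine (hM w).trans ((mul_le_mul_of_nonneg_left hw.le hM0).trans ?_)
  rw [mul_add]
  refine add_le_add le_rfl ?_
  rw [mul_div_assoc', div_le_iff₀ (by positivity)]
  nlinarith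

end Balanced

/-! ### The bimodule structure and the canonical map -/

section Bimodule

/-- The action of a scalar `r` of a normed ring as a bounded operator. -/
def smulL {R X : Type*} [SeminormedRing R] [NormedAddCommGroup X] [NormedSpace ℂ X] [Module R X]
    [IsBoundedSMul R X] [SMulCommClass R ℂ X] (r : R) : X →L[ℂ] X :=
  LinearMap.mkContinuous
    { toFun := fun x => r • x
      map_add' := smul_add r
      map_smul' := fun c x => smul_comm r c x } ‖r‖ (norm_smul_le r)

theorem norm_smulL_le {R X : Type*} [SeminormedRing R] [NormedAddCommGroup X] [NormedSpace ℂ X]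
    [Module R X] [IsBoundedSMul R X] [SMulCommClass R ℂ X] (r : R) : ‖smulL (X := X) r‖ ≤ ‖r‖ :=
  LinearMap.mkContinuous_norm_le _ (norm_nonneg _) _

variable (C : Type*) [CommCStarAlgebra C] (X Y : Type*)
  [NormedAddCommGroup X] [NormedSpace ℂ X] [Module C X] [Module Cᵐᵒᵖ X] [IsScalarTower ℂ C X]
  [IsBoundedSMul C X] [IsCentralScalar C X]
  [NormedAddCommGroup Y] [NormedSpace ℂ Y] [Module C Y] [Module Cᵐᵒᵖ Y] [IsScalarTower ℂ C Y]
  [IsBoundedSMul C Y] [IsCentralScalar C Y]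

variable {C X Y}

/-- The left multiplication `c (x ⊗ y) = cx ⊗ y`. -/
def leftMul (c : C) : ModTensor C X Y →L[ℂ] ModTensor C X Y :=
  modLift (modMk C X Y ∘L ptmap (smulL c) (.id ℂ Y)) fun x d y => by
    simp only [ContinuousLinearMap.comp_apply, ptmap_ptmul]
    rw [show smulL c (MulOpposite.op d • x) = MulOpposite.op d • c • x from smul_comm _ _ x]
    exact mtmul_balanced C (c • x) d y

/-- The right multiplication `(x ⊗ y) c = x ⊗ yc`. -/
def rightMul (c : Cᵐᵒᵖ) : ModTensor C X Y →L[ℂ] ModTensor C X Y :=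
  modLift (modMk C X Y ∘L ptmap (.id ℂ X) (smulL c)) fun x d y => by
    simp only [ContinuousLinearMap.comp_apply, ptmap_ptmul]
    rw [show smulL c (d • y) = d • c • y from smul_comm _ _ y]
    exact mtmul_balanced C x d (c • y)

theorem leftMul_mtmul (c : C) (x : X) (y : Y) :
    leftMul c (mtmul C x y) = mtmul C (c • x) y :=
  congrArg (modMk C X Y) (ptmap_ptmul _ _ x y)

theorem rightMul_mtmul (c : Cᵐᵒᵖ) (x : X) (y : Y) :
    rightMul c (mtmul C x y) = mtmul C x (c • y) :=
  congrArg (modMk C X Y) (ptmap_ptmul _ _ x y)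

theorem rightMul_op (c : C) : rightMul (X := X) (Y := Y) (MulOpposite.op c) = leftMul c :=
  modTensor_ext fun x y => by
    rw [rightMul_mtmul, leftMul_mtmul, op_smul_eq_smul, ← mtmul_balanced, op_smul_eq_smul]

theorem norm_leftMul_le (c : C) (z : ModTensor C X Y) : ‖leftMul c z‖ ≤ ‖c‖ * ‖z‖ := by
  refine norm_modLift_le _ _ (norm_nonneg c) (fun w => ?_) z
  refine (Submodule.Quotient.norm_mk_le (balancedKer C X Y) _).trans
    ((norm_ptmap_le _ _ w).trans (mul_le_mul_of_nonneg_right ?_ (norm_nonneg w)))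
  calc _ ≤ ‖c‖ * 1 := mul_le_mul (norm_smulL_le c) ContinuousLinearMap.norm_id_le
        (norm_nonneg _) (norm_nonneg _)
    _ = ‖c‖ := mul_one _

theorem mtmul_add_left (x x' : X) (y : Y) :
    mtmul C (x + x') y = mtmul C x y + mtmul C x' y := by
  simp [mtmul, add_ptmul]

theorem mtmul_smul_left (r : ℂ) (x : X) (y : Y) :
    mtmul C (r • x) y = r • mtmul C x y := by
  simp [mtmul, smul_ptmul]

/-- The left `C`-module structure, `c (x ⊗ y) = cx ⊗ y`. -/
instance : Module C (ModTensor C X Y) where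
  smul c z := leftMul c z
  one_smul z := DFunLike.congr_fun (f := leftMul (1 : C)) (g := .id ℂ _)
    (modTensor_ext fun x y => by simp [leftMul_mtmul]) z
  mul_smul c d z := DFunLike.congr_fun (f := leftMul (c * d)) (g := leftMul c ∘L leftMul d)
    (modTensor_ext fun x y => by simp [leftMul_mtmul, mul_smul]) z
  smul_zero c := map_zero (leftMul c)
  smul_add c := map_add (leftMul c)
  add_smul c d z := DFunLike.congr_fun (f := leftMul (c + d)) (g := leftMul c + leftMul d)
    (modTensor_ext fun x y => by simp [leftMul_mtmul, add_smul, mtmul_add_left]) z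
  zero_smul z := DFunLike.congr_fun (f := leftMul (0 : C)) (g := 0)
    (modTensor_ext fun x y => by
      rw [leftMul_mtmul, zero_smul, ← zero_smul ℂ (0 : X), mtmul_smul_left, zero_smul]; rfl) z

theorem smul_def (c : C) (z : ModTensor C X Y) : c • z = leftMul c z := rfl

/-- The right `C`-module structure, `(x ⊗ y) c = x ⊗ yc`. -/
instance : Module Cᵐᵒᵖ (ModTensor C X Y) where
  smul c z := rightMul c z
  one_smul z := by
    change rightMul (MulOpposite.op 1) z = z
    rw [rightMul_op, ← smul_def, one_smul]
  mul_smul c d z := by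
    change rightMul (MulOpposite.op (d.unop * c.unop)) z =
      rightMul (MulOpposite.op c.unop) (rightMul (MulOpposite.op d.unop) z)
    simp only [rightMul_op, ← smul_def]
    rw [mul_comm, mul_smul]
  smul_zero c := map_zero (rightMul c)
  smul_add c := map_add (rightMul c)
  add_smul c d z := by
    change rightMul (MulOpposite.op (c.unop + d.unop)) z =
      rightMul (MulOpposite.op c.unop) z + rightMul (MulOpposite.op d.unop) z
    simp only [rightMul_op, ← smul_def]
    rw [add_smul]
  zero_smul z := by
    change rightMul (MulOpposite.op 0) z = 0
    rw [rightMul_op, ← smul_def, zero_smul]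

instance : IsCentralScalar C (ModTensor C X Y) :=
  ⟨fun c z => DFunLike.congr_fun (rightMul_op c) z⟩

instance : IsScalarTower ℂ C (ModTensor C X Y) :=
  ⟨fun r c z => DFunLike.congr_fun (f := leftMul (r • c)) (g := r • leftMul c)
    (modTensor_ext fun x y => by simp [leftMul_mtmul, mtmul_smul_left]) z⟩

instance : IsBoundedSMul C (ModTensor C X Y) := IsBoundedSMul.of_norm_smul_le norm_leftMul_le

theorem toFiber_op_smul (t : WeakDual.characterSpace ℂ C) (c : C) (x : X) :
    toFiber C t (MulOpposite.op c • x) = t c • toFiber C t x := by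
  rw [op_smul_eq_smul, toFiber_smul]

/-- The contraction `x ⊗_C y ↦ x(t) ⊗ y(t)` into the projective tensor product of the fibres. -/
def kappaAt (t : WeakDual.characterSpace ℂ C) :
    ModTensor C X Y →L[ℂ] ProjTensor (Fiber C X t) (Fiber C Y t) :=
  modLift (ptmap (toFiber C t) (toFiber C t)) fun x c y => by
    rw [ptmap_ptmul, ptmap_ptmul, toFiber_op_smul, toFiber_smul, smul_ptmul, ptmul_smul]

theorem norm_kappaAt_le (t : WeakDual.characterSpace ℂ C) (z : ModTensor C X Y) :
    ‖kappaAt t z‖ ≤ ‖z‖ := by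
  have h := norm_modLift_le (C := C) (ptmap (toFiber C (X := X) t) (toFiber C (X := Y) t))
    (fun x c y => by
      rw [ptmap_ptmul, ptmap_ptmul, toFiber_op_smul, toFiber_smul, smul_ptmul, ptmul_smul])
    zero_le_one (fun w => (norm_ptmap_le _ _ w).trans (mul_le_mul_of_nonneg_right
      (mul_le_one₀ (norm_toFiber_le C t) (norm_nonneg _) (norm_toFiber_le C t)) (norm_nonneg w))) z
  rwa [one_mul] at h

variable (C X Y)

/-- The natural contraction `κ` into the `ℓ^∞`-direct sum over the spectrum (all bounded families,
with the supremum norm), `κ (x ⊗_C y) = (x(t) ⊗ y(t))_t`. -/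
def kappa : ModTensor C X Y →L[ℂ]
    lp (fun t : WeakDual.characterSpace ℂ C => ProjTensor (Fiber C X t) (Fiber C Y t)) ∞ :=
  LinearMap.mkContinuous
    { toFun := fun z => ⟨fun t => kappaAt t z, memℓp_infty
        ⟨‖z‖, by rintro _ ⟨t, rfl⟩; exact norm_kappaAt_le t z⟩⟩
      map_add' := fun z z' => by ext t; exact map_add (kappaAt t) z z'
      map_smul' := fun r z => by ext t; exact map_smul (kappaAt t) r z }
    1 fun z => by
      rw [one_mul]
      exact lp.norm_le_of_forall_le (norm_nonneg z) fun t => norm_kappaAt_le t z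

theorem kappa_mtmul (x : X) (y : Y) (t : WeakDual.characterSpace ℂ C) :
    kappa C X Y (mtmul C x y) t = ptmul (toFiber C t x) (toFiber C t y) :=
  ptmap_ptmul _ _ x y

end Bimodule

end CentralBimodule

end

noncomputable section

namespace CentralBimodule

/-! ### Convexity of representable central bimodules -/

section Convexity

/-! The heart is that every nonzero `z` in the module tensor product is normed by a functional `θ`
that is homogeneous for some character `t`, i.e. `θ (c w) = t(c) θ(w)`
(`exists_norming_functional`). Such a `θ` factors through `X(t) ⊗ Y(t)` as a form of norm at most
`1`, so `‖z‖ = |θ z| ≤ ‖κ(z)(t)‖`, which gives the isometry. Letting all such pairs `(t, θ)` act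
diagonally on `ℓ²` gives the representation.

To find `θ`, take an extreme point of the weak-* compact convex set of functionals in the unit ball
that attain `‖z‖` at `z`. If `‖θ c‖ + ‖θ (1 - c)‖ ≤ 1` whenever `0 ≤ c ≤ 1`, extremality makes `θ c`
a multiple of `θ`, and the multiplier is a character.

This additivity is dual to `C`-convexity: `c (x ⊗ y) + (1 - c) (x' ⊗ y')` has norm at most `1` for
vectors in the unit balls (`norm_smul_mtmul_add_le`). Representability gives `C`-convexity of `X`
and of `Y`, but tensoring two convex combinations squares the coefficients. When `c` is nearly a
projection the squaring is harmless; in general `N c` is a sum of `N` elements that are nearly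
projections with total error at most `1`, and the error disappears after division by `N`. -/

theorem norm_star_map_sq_add {A H : Type*} [CStarAlgebra A] [NormedAddCommGroup H]
    [InnerProductSpace ℂ H] [CompleteSpace H] (π : A →⋆ₐ[ℂ] (H →L[ℂ] H)) {a b : A}
    (ha : IsSelfAdjoint a) (hb : IsSelfAdjoint b) (hab : a * a + b * b = 1) (v : H) :
    ‖π a v‖ ^ 2 + ‖π b v‖ ^ 2 = ‖v‖ ^ 2 := by
  have key : ∀ c : A, IsSelfAdjoint c → inner ℂ v (π (c * c) v) = (‖π c v‖ : ℂ) ^ 2 := by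
    intro c hc
    have hc' : ContinuousLinearMap.adjoint (π c) = π c := by
      rw [← ContinuousLinearMap.star_eq_adjoint, ← map_star, hc.star_eq]
    rw [map_mul, mul_apply_eq_comp, ← ContinuousLinearMap.adjoint_inner_left, hc',
      inner_self_eq_norm_sq_to_K]
    rfl
  have h : inner ℂ v (π (a * a) v) + inner ℂ v (π (b * b) v) = (‖v‖ : ℂ) ^ 2 := by
    rw [← inner_add_right, ← add_apply, ← map_add, hab, map_one,
      one_apply_eq_self, inner_self_eq_norm_sq_to_K]
    rfl
  rw [key a ha, key b hb] at h
  exact_mod_cast h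

/-- By centrality `c² z = c z c`, so one factor `c` can be placed on each side of `Φ z`. The
operator is then a row `(π a, π b)` times a diagonal contraction times a column `(σ a, σ b)`, and
row and column are contractions because `a² + b² = 1`. -/
theorem IsRepresentable.norm_add_le_one {C X : Type*} [CommCStarAlgebra C] [NormedAddCommGroup X]
    [NormedSpace ℂ X] [Module C X] [Module Cᵐᵒᵖ X] [IsCentralScalar C X]
    (hX : IsRepresentable.{w₁} C C X) {a b : C} (ha : IsSelfAdjoint a) (hb : IsSelfAdjoint b)
    (hab : a * a + b * b = 1) {x y : X} (hx : ‖x‖ ≤ 1) (hy : ‖y‖ ≤ 1) :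
    ‖(a * a) • x + (b * b) • y‖ ≤ 1 := by
  obtain ⟨H, _, _, _, K, _, _, _, π, σ, Φ, hl, hr⟩ := hX
  have hΦ : ∀ (c : C) (z : X), Φ ((c * c) • z) = π c ∘L Φ z ∘L σ c := fun c z => by
    rw [mul_smul, hl, ← op_smul_eq_smul c z, hr]
  rw [← Φ.norm_map, map_add, hΦ, hΦ]
  refine ContinuousLinearMap.opNorm_le_bound _ zero_le_one fun v => ?_
  rw [one_mul]
  set T := π a ∘L Φ x ∘L σ a + π b ∘L Φ y ∘L σ b with hT
  have hadj : ∀ (c : C), IsSelfAdjoint c → ContinuousLinearMap.adjoint (π c) = π c := by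
    intro c hc
    rw [← ContinuousLinearMap.star_eq_adjoint, ← map_star, hc.star_eq]
  have hterm : ∀ (c : C) (z : X), IsSelfAdjoint c → ‖z‖ ≤ 1 → ∀ u : H,
      ‖inner ℂ u ((π c ∘L Φ z ∘L σ c) v)‖ ≤ ‖π c u‖ * ‖σ c v‖ := by
    intro c z hc hz u
    rw [ContinuousLinearMap.comp_apply, ContinuousLinearMap.comp_apply,
      ← ContinuousLinearMap.adjoint_inner_left, hadj c hc]
    refine (norm_inner_le_norm _ _).trans (mul_le_mul_of_nonneg_left ?_ (norm_nonneg _))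
    refine ((Φ z).le_opNorm _).trans ?_
    rw [Φ.norm_map]
    exact mul_le_of_le_one_left (norm_nonneg _) hz
  -- Pair `T v` with itself; the two resulting terms are estimated by Cauchy–Schwarz in the plane.
  have hu : ‖T v‖ ^ 2 ≤ ‖T v‖ * ‖v‖ := by
    set u := T v with huT
    have h1 : ‖u‖ ^ 2 = ‖inner ℂ u (T v)‖ := by
      rw [← huT, inner_self_eq_norm_sq_to_K]
      simp
    rw [h1, hT, add_apply, inner_add_right]
    refine (norm_add_le _ _).trans ((add_le_add (hterm a x ha hx u) (hterm b y hb hy u)).trans ?_)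
    have h2 := norm_star_map_sq_add π ha hb hab u
    have h3 := norm_star_map_sq_add σ ha hb hab v
    refine abs_le_of_sq_le_sq' ?_ (by positivity) |>.2
    rw [mul_pow, ← h2, ← h3]
    nlinarith [sq_nonneg (‖π a u‖ * ‖σ b v‖ - ‖π b u‖ * ‖σ a v‖)]
  rcases (norm_nonneg (T v)).eq_or_lt with h | h
  · rw [← h]; positivity
  · rw [sq] at hu
    exact le_of_mul_le_mul_left hu h

end Convexity

/-! ### Norm estimates in the module tensor product -/

section ModTensorNorm

theorem norm_ptmul_le {X Y : Type*} [SeminormedAddCommGroup X] [NormedSpace ℂ X]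
    [SeminormedAddCommGroup Y] [NormedSpace ℂ Y] (x : X) (y : Y) : ‖ptmul x y‖ ≤ ‖x‖ * ‖y‖ := by
  unfold ptmul
  rw [UniformSpace.Completion.norm_coe]
  exact projNorm_le (projCosts_tmul x y)

/-- A bound on elementary tensors holds for the cost of every representation of an algebraic tensor,
hence for the infimum, and passes to the completion by density. -/
theorem norm_le_of_norm_ptmul_le {X Y E : Type*} [SeminormedAddCommGroup X] [NormedSpace ℂ X]
    [SeminormedAddCommGroup Y] [NormedSpace ℂ Y] [NormedAddCommGroup E] [NormedSpace ℂ E]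
    (f : ProjTensor X Y →L[ℂ] E) {M : ℝ} (hM : 0 ≤ M)
    (hf : ∀ x y, ‖f (ptmul x y)‖ ≤ M * (‖x‖ * ‖y‖)) (w : ProjTensor X Y) : ‖f w‖ ≤ M * ‖w‖ := by
  induction w using UniformSpace.Completion.induction_on with
  | hp => exact isClosed_le (by fun_prop) (by fun_prop)
  | ih w =>
    rw [UniformSpace.Completion.norm_coe]
    change _ ≤ M * sInf (projCosts (X := X) (Y := Y) w)
    rw [← smul_eq_mul M, ← Real.sInf_smul_of_nonneg hM]
    refine le_csInf ((projCosts_nonempty _).smul_set) ?_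
    rintro _ ⟨r, ⟨n, x, y, rfl, rfl⟩, rfl⟩
    have h : ((∑ i, x i ⊗ₜ[ℂ] y i : AlgTensor X Y) : UniformSpace.Completion (AlgTensor X Y)) =
        ∑ i, ptmul (x i) (y i) :=
      map_sum (UniformSpace.Completion.toComplL (𝕜 := ℂ) (E := AlgTensor X Y)) _ _
    change ‖f ((∑ i, x i ⊗ₜ[ℂ] y i : AlgTensor X Y) : UniformSpace.Completion (AlgTensor X Y))‖ ≤
      M * ∑ i, ‖x i‖ * ‖y i‖
    rw [h, map_sum, Finset.mul_sum]
    exact (norm_sum_le _ _).trans (Finset.sum_le_sum fun i _ => hf _ _)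

variable {C X Y : Type*} [CommCStarAlgebra C]
  [NormedAddCommGroup X] [NormedSpace ℂ X] [Module C X] [Module Cᵐᵒᵖ X] [IsScalarTower ℂ C X]
  [IsBoundedSMul C X] [IsCentralScalar C X]
  [NormedAddCommGroup Y] [NormedSpace ℂ Y] [Module C Y] [Module Cᵐᵒᵖ Y] [IsScalarTower ℂ C Y]
  [IsBoundedSMul C Y] [IsCentralScalar C Y]

theorem norm_mtmul_le (x : X) (y : Y) : ‖mtmul C x y‖ ≤ ‖x‖ * ‖y‖ :=
  (Submodule.Quotient.norm_mk_le (balancedKer C X Y) _).trans (norm_ptmul_le x y)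

theorem norm_le_of_norm_mtmul_le {E : Type*} [NormedAddCommGroup E] [NormedSpace ℂ E]
    (f : ModTensor C X Y →L[ℂ] E) {M : ℝ} (hM : 0 ≤ M)
    (hf : ∀ x y, ‖x‖ ≤ 1 → ‖y‖ ≤ 1 → ‖f (mtmul C x y)‖ ≤ M) : ‖f‖ ≤ M := by
  have hf' : ∀ x y, ‖f (mtmul C x y)‖ ≤ M * (‖x‖ * ‖y‖) := by
    intro x y
    -- Normalise both vectors. If one of them is `0`, its inverse norm is `0` and both sides vanish.
    have h : mtmul C x y = ((‖x‖ * ‖y‖ : ℝ) : ℂ) •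
        mtmul C (((‖x‖ : ℂ)⁻¹) • x) (((‖y‖ : ℂ)⁻¹) • y) := by
      unfold mtmul
      rw [smul_ptmul, ptmul_smul, map_smul, map_smul, smul_smul, smul_smul]
      rcases eq_or_ne x 0 with rfl | hx
      · have : ptmul (0 : X) y = 0 := by rw [← zero_smul ℂ (0 : X), smul_ptmul, zero_smul]
        simp [this]
      rcases eq_or_ne y 0 with rfl | hy
      · have : ptmul x (0 : Y) = 0 := by rw [← zero_smul ℂ (0 : Y), ptmul_smul, zero_smul]
        simp [this]
      have hx' : (‖x‖ : ℂ) ≠ 0 := by simpa using hx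
      have hy' : (‖y‖ : ℂ) ≠ 0 := by simpa using hy
      rw [show ((‖x‖ * ‖y‖ : ℝ) : ℂ) * (‖x‖ : ℂ)⁻¹ * (‖y‖ : ℂ)⁻¹ = 1 by
        push_cast; field_simp, one_smul]
    rw [h, map_smul, norm_smul, Complex.norm_real, Real.norm_of_nonneg (by positivity), mul_comm]
    refine mul_le_mul_of_nonneg_right (hf _ _ ?_ ?_) (by positivity) <;>
    · rw [norm_smul, norm_inv, Complex.norm_real, norm_norm]
      exact inv_mul_le_one
  refine ContinuousLinearMap.opNorm_le_bound _ hM fun z => ?_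
  have hlift : modLift (f ∘L modMk C X Y) (fun x c y => congrArg f (mtmul_balanced C x c y)) = f :=
    modTensor_ext fun x y => rfl
  have h := norm_modLift_le (f ∘L modMk C X Y)
    (fun x c y => congrArg f (mtmul_balanced C x c y)) hM
    (norm_le_of_norm_ptmul_le _ hM hf') z
  rwa [hlift] at h

theorem smul_mtmul (c : C) (x : X) (y : Y) : c • mtmul C x y = mtmul C (c • x) y :=
  leftMul_mtmul c x y

theorem mtmul_smul (c : C) (x : X) (y : Y) : mtmul C x (c • y) = c • mtmul C x y := by
  rw [smul_mtmul, ← mtmul_balanced, op_smul_eq_smul]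

theorem mtmul_add (x : X) (y y' : Y) : mtmul C x (y + y') = mtmul C x y + mtmul C x y' := by
  simp [mtmul, ptmul_add]

theorem mtmul_neg (x : X) (y : Y) : mtmul C x (-y) = -mtmul C x y := by
  rw [← neg_one_smul ℂ y, mtmul, ptmul_smul, map_smul, neg_one_smul]; rfl

theorem neg_mtmul (x : X) (y : Y) : mtmul C (-x) y = -mtmul C x y := by
  rw [← neg_one_smul ℂ x, mtmul_smul_left, neg_one_smul]

/-- Expand the tensor of two `C`-convex combinations. Replacing `(x', y')` by `(-x', -y')` reverses
the cross terms and keeps the diagonal ones, so the average of the two expansions is the sum in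
question. -/
theorem norm_sq_smul_mtmul_add_le (hX : IsRepresentable.{w₁} C C X)
    (hY : IsRepresentable.{w₂} C C Y) {a b : C} (ha : IsSelfAdjoint a) (hb : IsSelfAdjoint b)
    (hab : a * a + b * b = 1) {x x' : X} {y y' : Y} (hx : ‖x‖ ≤ 1) (hx' : ‖x'‖ ≤ 1)
    (hy : ‖y‖ ≤ 1) (hy' : ‖y'‖ ≤ 1) :
    ‖(a * a) ^ 2 • mtmul C x y + (b * b) ^ 2 • mtmul C x' y'‖ ≤ 1 := by
  have h : ∀ (x' : X) (y' : Y), ‖x'‖ ≤ 1 → ‖y'‖ ≤ 1 →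
      ‖mtmul C ((a * a) • x + (b * b) • x') ((a * a) • y + (b * b) • y')‖ ≤ 1 := by
    intro x' y' hx' hy'
    exact (norm_mtmul_le _ _).trans (mul_le_one₀ (hX.norm_add_le_one ha hb hab hx hx')
      (norm_nonneg _) (hY.norm_add_le_one ha hb hab hy hy'))
  have h1 := h x' y' hx' hy'
  have h2 := h (-x') (-y') (by rwa [norm_neg]) (by rwa [norm_neg])
  set z := (a * a) ^ 2 • mtmul C x y + (b * b) ^ 2 • mtmul C x' y' with hz
  have key : z + z = mtmul C ((a * a) • x + (b * b) • x') ((a * a) • y + (b * b) • y') +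
      mtmul C ((a * a) • x + (b * b) • (-x')) ((a * a) • y + (b * b) • (-y')) := by
    simp only [hz, mtmul_add, mtmul_add_left, mtmul_smul, ← smul_mtmul, mtmul_neg, neg_mtmul,
      smul_neg, sq, mul_smul]
    module
  have h3 : ‖z + z‖ = 2 * ‖z‖ := by rw [← two_smul ℂ z, norm_smul]; norm_num
  have h4 := (norm_add_le _ _).trans (add_le_add h1 h2)
  rw [← key, h3] at h4
  linarith

end ModTensorNorm

/-! ### Removing the squares: `C`-convexity of the tensor norm and its dual form -/

section Partition

/-- The function that climbs linearly from `0` to `1` on the interval `[k, k + 1]`. -/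
def ramp (k : ℕ) (u : ℝ) : ℝ := min u (k + 1) - min u k

@[fun_prop]
theorem continuous_ramp (k : ℕ) : Continuous (ramp k) := by unfold ramp; fun_prop

theorem ramp_nonneg (k : ℕ) (u : ℝ) : 0 ≤ ramp k u :=
  sub_nonneg.2 (min_le_min le_rfl (by linarith))

theorem ramp_le_one (k : ℕ) (u : ℝ) : ramp k u ≤ 1 := by
  unfold ramp
  rcases le_total u k with h | h
  · rw [min_eq_left h]; linarith [min_le_left u ((k : ℝ) + 1)]
  · rw [min_eq_right h]; linarith [min_le_right u ((k : ℝ) + 1)]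

theorem sum_ramp (N : ℕ) {u : ℝ} (h0 : 0 ≤ u) (hN : u ≤ N) :
    ∑ k ∈ Finset.range N, ramp k u = u := by
  have := Finset.sum_range_sub (fun k : ℕ => min u (k : ℝ)) N
  simp only [Nat.cast_add, Nat.cast_one, Nat.cast_zero, min_eq_left hN, min_eq_right h0,
    sub_zero] at this
  exact this

theorem sum_ramp_mul_le_one (N : ℕ) {u : ℝ} (h0 : 0 ≤ u) :
    ∑ k ∈ Finset.range N, ramp k u * (1 - ramp k u) ≤ 1 := by
  -- Away from `k = ⌊u⌋` the ramp is exactly `0` or `1`, so at most one term survives, whatever `N`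
  -- is.
  have h : ∀ k ∈ Finset.range N, k ≠ ⌊u⌋₊ → ramp k u * (1 - ramp k u) = 0 := by
    intro k _ hk
    rcases lt_or_gt_of_ne hk with h | h
    · have h1 : (k : ℝ) + 1 ≤ u :=
        le_trans (by exact_mod_cast h) (Nat.floor_le h0)
      rw [ramp, min_eq_right h1, min_eq_right (by linarith)]
      ring
    · have h1 : u ≤ k := ((Nat.floor_lt h0).1 h).le
      rw [ramp, min_eq_left h1, min_eq_left (by linarith)]
      ring
  have hle : ∀ k, ramp k u * (1 - ramp k u) ≤ 1 := fun k => by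
    nlinarith [ramp_nonneg k u, ramp_le_one k u]
  by_cases hm : ⌊u⌋₊ ∈ Finset.range N
  · rw [Finset.sum_eq_single_of_mem _ hm h]
    exact hle _
  · rw [Finset.sum_eq_zero fun k hk => h k hk fun hk' => hm (hk' ▸ hk)]
    exact zero_le_one

variable {C : Type*} [CommCStarAlgebra C]

/-- Approximate spectral steps: `N c` is a sum of `N` elements `aₖ²` between `0` and `1`, of which
`aₖ² (1 - aₖ²)` is small in total. -/
theorem exists_partition {c : C} (hc : IsSelfAdjoint c) (hs : spectrum ℝ c ⊆ Set.Icc 0 1) (N : ℕ) :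
    ∃ a b : ℕ → C, (∀ k, IsSelfAdjoint (a k)) ∧ (∀ k, IsSelfAdjoint (b k)) ∧
      (∀ k, a k * a k + b k * b k = 1) ∧ ∑ k ∈ Finset.range N, a k * a k = (N : ℝ) • c ∧
      ‖∑ k ∈ Finset.range N, a k * a k * (b k * b k)‖ ≤ 1 := by
  have ha : ∀ k : ℕ, cfc (fun s : ℝ => √(ramp k (N * s))) c *
      cfc (fun s : ℝ => √(ramp k (N * s))) c = cfc (fun s : ℝ => ramp k (N * s)) c := by
    intro k
    rw [← cfc_mul _ _ c (by fun_prop) (by fun_prop)]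
    simp only [Real.mul_self_sqrt (ramp_nonneg _ _)]
  have hb : ∀ k : ℕ, cfc (fun s : ℝ => √(1 - ramp k (N * s))) c *
      cfc (fun s : ℝ => √(1 - ramp k (N * s))) c = cfc (fun s : ℝ => 1 - ramp k (N * s)) c := by
    intro k
    rw [← cfc_mul _ _ c (by fun_prop) (by fun_prop)]
    simp only [Real.mul_self_sqrt (sub_nonneg.2 (ramp_le_one _ _))]
  -- The choice is `aₖ² = ramp k (N c)` and `bₖ² = 1 - aₖ²`; the ramps add up to `N c` because the
  -- spectrum of `N c` lies in `[0, N]`.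
  refine ⟨fun k => cfc (fun s : ℝ => √(ramp k (N * s))) c,
    fun k => cfc (fun s : ℝ => √(1 - ramp k (N * s))) c, fun k => cfc_predicate _ _,
    fun k => cfc_predicate _ _, fun k => ?_, ?_, ?_⟩
  · dsimp only
    rw [ha, hb, ← cfc_add (a := c) _ _ (by fun_prop)
      (by fun_prop)]
    simp only [add_sub_cancel]
    exact cfc_const_one ℝ c
  · simp only [ha]
    rw [← cfc_sum _ c _ (fun k _ => by fun_prop), ← cfc_const_mul_id (N : ℝ) c]
    refine cfc_congr fun s hs' => ?_
    rw [Finset.sum_apply]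
    have := hs hs'
    exact sum_ramp N (by have := this.1; positivity)
      (mul_le_of_le_one_right (Nat.cast_nonneg N) this.2)
  · simp only [ha, hb]
    have h : ∀ k : ℕ, cfc (fun s : ℝ => ramp k (N * s)) c *
        cfc (fun s : ℝ => 1 - ramp k (N * s)) c =
        cfc (fun s : ℝ => ramp k (N * s) * (1 - ramp k (N * s))) c := fun k =>
      (cfc_mul _ _ c (by fun_prop) (by fun_prop)).symm
    simp only [h]
    rw [← cfc_sum _ c _ (fun k _ => by fun_prop)]
    refine norm_cfc_le zero_le_one fun s hs' => ?_
    rw [Finset.sum_apply, Real.norm_of_nonneg (Finset.sum_nonneg fun k _ =>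
      mul_nonneg (ramp_nonneg _ _) (sub_nonneg.2 (ramp_le_one _ _)))]
    exact sum_ramp_mul_le_one N (by have := (hs hs').1; positivity)

variable {X Y : Type*}
  [NormedAddCommGroup X] [NormedSpace ℂ X] [Module C X] [Module Cᵐᵒᵖ X] [IsScalarTower ℂ C X]
  [IsBoundedSMul C X] [IsCentralScalar C X]
  [NormedAddCommGroup Y] [NormedSpace ℂ Y] [Module C Y] [Module Cᵐᵒᵖ Y] [IsScalarTower ℂ C Y]
  [IsBoundedSMul C Y] [IsCentralScalar C Y]

/-- On elementary tensors of unit vectors, the norm of the module tensor product is convex with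
respect to coefficients `0 ≤ c ≤ 1` in `C`. -/
theorem norm_smul_mtmul_add_le (hX : IsRepresentable.{w₁} C C X)
    (hY : IsRepresentable.{w₂} C C Y) {c : C} (hc : IsSelfAdjoint c)
    (hs : spectrum ℝ c ⊆ Set.Icc 0 1) {x x' : X} {y y' : Y} (hx : ‖x‖ ≤ 1) (hx' : ‖x'‖ ≤ 1)
    (hy : ‖y‖ ≤ 1) (hy' : ‖y'‖ ≤ 1) :
    ‖c • mtmul C x y + (1 - c) • mtmul C x' y'‖ ≤ 1 := by
  set z := mtmul C x y with hz
  set z' := mtmul C x' y' with hz'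
  have hz1 : ‖z‖ ≤ 1 := (norm_mtmul_le x y).trans (mul_le_one₀ hx (norm_nonneg _) hy)
  have hz1' : ‖z'‖ ≤ 1 := (norm_mtmul_le x' y').trans (mul_le_one₀ hx' (norm_nonneg _) hy')
  -- Each of the `N` blocks has norm at most `1`; the `2` pays for the error `r`, which hits both
  -- `z` and `z'`. The bound follows as `N → ∞`.
  have key : ∀ N : ℕ, N * ‖c • z + (1 - c) • z'‖ ≤ N + 2 := by
    intro N
    obtain ⟨a, b, ha, hb, hab, hsum, hr⟩ := exists_partition hc hs N
    set r := ∑ k ∈ Finset.range N, a k * a k * (b k * b k) with hrdef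
    have h1 : (N : ℝ) • c = (N : C) * c := by
      rw [Nat.cast_smul_eq_nsmul, nsmul_eq_mul]
    rw [h1] at hsum
    have h2 : ∑ k ∈ Finset.range N, (a k * a k) ^ 2 = N * c - r := by
      rw [← hsum, hrdef, ← Finset.sum_sub_distrib]
      -- From `a² + b² = 1`: `a⁴ = a² - a² b²`, and likewise `b⁴ = (1 - a²) - a² b²` below.
      exact Finset.sum_congr rfl fun k _ => by linear_combination (a k * a k) * hab k
    have h3 : ∑ k ∈ Finset.range N, (b k * b k) ^ 2 = N * (1 - c) - r := by
      have : (N : C) * (1 - c) = ∑ k ∈ Finset.range N, (1 - a k * a k) := by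
        rw [Finset.sum_sub_distrib, hsum]
        simp [mul_sub]
      rw [this, hrdef, ← Finset.sum_sub_distrib]
      exact Finset.sum_congr rfl fun k _ => by linear_combination (b k * b k + 1) * hab k
    have h4 : (N : ℂ) • (c • z + (1 - c) • z') = (∑ k ∈ Finset.range N,
        ((a k * a k) ^ 2 • z + (b k * b k) ^ 2 • z')) + (r • z + r • z') := by
      rw [Finset.sum_add_distrib, ← Finset.sum_smul, ← Finset.sum_smul, h2, h3,
        Nat.cast_smul_eq_nsmul, ← Nat.cast_smul_eq_nsmul C]
      module
    have h5 : ‖(N : ℂ) • (c • z + (1 - c) • z')‖ ≤ N + 2 := by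
      rw [h4]
      refine (norm_add_le _ _).trans (add_le_add ?_ ?_)
      · refine (norm_sum_le_of_le _ fun k _ =>
          norm_sq_smul_mtmul_add_le hX hY (ha k) (hb k) (hab k) hx hx' hy hy').trans ?_
        simp
      · have h6 := norm_add_le (r • z) (r • z')
        have h7 := (norm_smul_le r z).trans (mul_le_one₀ hr (norm_nonneg _) hz1)
        have h8 := (norm_smul_le r z').trans (mul_le_one₀ hr (norm_nonneg _) hz1')
        linarith
    rwa [norm_smul, Complex.norm_natCast] at h5
  by_contra! hlt
  obtain ⟨N, hN⟩ := exists_nat_gt (2 / (‖c • z + (1 - c) • z'‖ - 1))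
  rw [div_lt_iff₀ (by linarith)] at hN
  linarith [key N]

/-- The dual of `C`-convexity: the two elementary tensors are chosen independently, so both norms
can be approached at once. -/
theorem norm_comp_smulL_add_le (hX : IsRepresentable.{w₁} C C X)
    (hY : IsRepresentable.{w₂} C C Y) {c : C} (hc : IsSelfAdjoint c)
    (hs : spectrum ℝ c ⊆ Set.Icc 0 1) {θ : StrongDual ℂ (ModTensor C X Y)} (hθ : ‖θ‖ ≤ 1) :
    ‖θ ∘L smulL c‖ + ‖θ ∘L smulL (1 - c)‖ ≤ 1 := by
  have key : ∀ {x x' : X} {y y' : Y}, ‖x‖ ≤ 1 → ‖x'‖ ≤ 1 → ‖y‖ ≤ 1 → ‖y'‖ ≤ 1 →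
      ‖θ (c • mtmul C x y)‖ + ‖θ ((1 - c) • mtmul C x' y')‖ ≤ 1 := by
    intro x x' y y' hx hx' hy hy'
    -- Unimodular phases, absorbed into `x` and `x'`, make both values nonnegative so that they add
    -- without cancellation.
    obtain ⟨u, hu, hu'⟩ := Complex.exists_norm_eq_mul_self (θ (c • mtmul C x y))
    obtain ⟨v, hv, hv'⟩ := Complex.exists_norm_eq_mul_self (θ ((1 - c) • mtmul C x' y'))
    have h := norm_smul_mtmul_add_le hX hY hc hs (x := u • x) (x' := v • x')
      (by rwa [norm_smul, hu, one_mul]) (by rwa [norm_smul, hv, one_mul]) hy hy'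
    have h' : θ (c • mtmul C (u • x) y + (1 - c) • mtmul C (v • x') y') =
        ((‖θ (c • mtmul C x y)‖ + ‖θ ((1 - c) • mtmul C x' y')‖ : ℝ) : ℂ) := by
      rw [mtmul_smul_left, mtmul_smul_left, smul_comm c u, smul_comm (1 - c) v, map_add,
        θ.map_smul, θ.map_smul, smul_eq_mul, smul_eq_mul, ← hu', ← hv', Complex.ofReal_add]
    have h'' := (θ.le_opNorm _).trans (mul_le_one₀ hθ (norm_nonneg _) h)
    rwa [h', Complex.norm_real, Real.norm_of_nonneg (by positivity)] at h''
  -- Take the supremum over `(x, y)` with `(x', y')` fixed, then over `(x', y')`. Zero vectors serve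
  -- only to show that the bounds are nonnegative.
  have h1 : ∀ {x' : X} {y' : Y}, ‖x'‖ ≤ 1 → ‖y'‖ ≤ 1 →
      ‖θ ∘L smulL c‖ ≤ 1 - ‖θ ((1 - c) • mtmul C x' y')‖ := by
    intro x' y' hx' hy'
    refine norm_le_of_norm_mtmul_le _ ?_ fun x y hx hy => ?_
    · have := key (x := 0) (y := 0) (by simp) hx' (by simp) hy'
      linarith [norm_nonneg (θ (c • mtmul C (0 : X) (0 : Y)))]
    · exact le_sub_iff_add_le.2 (key hx hx' hy hy')
  have h2 : ‖θ ∘L smulL (1 - c)‖ ≤ 1 - ‖θ ∘L smulL c‖ := by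
    refine norm_le_of_norm_mtmul_le _ ?_ fun x y hx hy => ?_
    · have := h1 (x' := 0) (y' := 0) (by simp) (by simp)
      linarith [norm_nonneg (θ ((1 - c) • mtmul C (0 : X) (0 : Y)))]
    · exact le_sub_comm.1 (h1 hx hy)
  linarith

end Partition

/-! ### Extreme norming functionals -/

section ExtremeFunctionals

theorem _root_.WeakDual.locallyConvexSpace_real {E : Type*} [NormedAddCommGroup E]
    [NormedSpace ℂ E] : LocallyConvexSpace ℝ (WeakDual ℂ E) := by
  have : IsScalarTower ℝ ℂ (WeakDual ℂ E) :=
    ⟨fun r c θ => DFunLike.ext _ _ fun v => smul_assoc r c (θ v)⟩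
  exact (WeakDual.withSeminorms ℂ E).toLocallyConvexSpace

variable {C Z : Type*} [CommCStarAlgebra C] [NormedAddCommGroup Z] [NormedSpace ℂ Z] [Module C Z]
  [IsScalarTower ℂ C Z] [IsBoundedSMul C Z]

/-- The functionals of norm at most `1` that attain their norm at `z`. -/
def normingSet (z : Z) : Set (WeakDual ℂ Z) :=
  {θ | ‖WeakDual.toStrongDual θ‖ ≤ 1 ∧ θ z = ‖z‖}

/-- Banach–Alaoglu gives compactness, Hahn–Banach a point of the set, and Krein–Milman an extreme
point. -/
theorem extremePoints_normingSet_nonempty {z : Z} (hz : z ≠ 0) :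
    ((normingSet z).extremePoints ℝ).Nonempty := by
  have hcomp : IsCompact (normingSet z) := by
    have h : normingSet z = WeakDual.toStrongDual ⁻¹' Metric.closedBall (0 : StrongDual ℂ Z) 1 ∩
        {θ : WeakDual ℂ Z | θ z = ‖z‖} := by
      ext θ
      simp [normingSet]
    rw [h]
    exact (WeakDual.isCompact_closedBall _ _).inter_right
      (isClosed_eq (WeakDual.eval_continuous z) continuous_const)
  have hne : (normingSet z).Nonempty := by
    obtain ⟨g, hg, hgz⟩ := exists_dual_vector ℂ z (norm_ne_zero_iff.2 hz)
    exact ⟨StrongDual.toWeakDual g, hg.le, hgz⟩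
  have := WeakDual.locallyConvexSpace_real (E := Z)
  have hsmul : ContinuousSMul ℝ (WeakDual ℂ Z) := WeakDual.instContinuousSMul ℝ
  exact IsCompact.extremePoints_nonempty (E := WeakDual ℂ Z) hcomp hne

/-- If multiplication by `c` and `1 - c` splits the norm of an extreme norming functional `θ`
additively, then `c` acts on `θ` as a scalar. -/
theorem extreme_comp_smulL {z : Z} (hz : z ≠ 0) {θ : WeakDual ℂ Z}
    (hθ : θ ∈ (normingSet z).extremePoints ℝ) {c : C}
    (hc : ‖WeakDual.toStrongDual θ ∘L smulL c‖ + ‖WeakDual.toStrongDual θ ∘L smulL (1 - c)‖ ≤ 1)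
    (w : Z) : θ (c • w) * ‖z‖ = θ (c • z) * θ w := by
  have hz0 : 0 < ‖z‖ := norm_pos_iff.2 hz
  set φ : StrongDual ℂ Z := WeakDual.toStrongDual θ ∘L smulL c with hφ
  set ψ : StrongDual ℂ Z := WeakDual.toStrongDual θ ∘L smulL (1 - c) with hψ
  have hφa : ∀ w, φ w = θ (c • w) := fun w => rfl
  have hadd : ∀ w, φ w + ψ w = θ w := fun w => by
    change θ (c • w) + θ ((1 - c) • w) = θ w
    rw [← map_add, ← add_smul, add_sub_cancel, one_smul]
  obtain ⟨⟨hθ1, hθz⟩, hext⟩ := mem_extremePoints.1 hθ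
  have hsum : φ z + ψ z = ‖z‖ := (hadd z).trans hθz
  have hφz := φ.le_opNorm z
  have hψz := ψ.le_opNorm z
  have hre : (φ z).re + (ψ z).re = ‖z‖ := by
    simpa using congrArg Complex.re hsum
  have h1 := Complex.re_le_norm (φ z)
  have h2 := Complex.re_le_norm (ψ z)
  -- The chain `‖z‖ = Re φ z + Re ψ z ≤ ‖φ z‖ + ‖ψ z‖ ≤ (‖φ‖ + ‖ψ‖) ‖z‖ ≤ ‖z‖` collapses to
  -- equalities, so `φ` and `ψ` both attain their norms at `z` with nonnegative values.
  have h3 : (‖φ‖ + ‖ψ‖) * ‖z‖ ≤ ‖z‖ := mul_le_of_le_one_left hz0.le hc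
  have hnormsum : ‖φ‖ + ‖ψ‖ = 1 :=
    le_antisymm hc (le_of_mul_le_mul_right (by linarith) hz0)
  have hval : ∀ u : ℂ, ‖u‖ ≤ u.re → u = u.re := fun u hu =>
    (RCLike.norm_le_re_iff_eq_norm.1 hu).trans <| by
      rw [← le_antisymm (Complex.re_le_norm u) hu]
      rfl
  have hφv : φ z = (‖φ‖ * ‖z‖ : ℝ) := by
    rw [hval (φ z) (by nlinarith)]
    congr 1
    nlinarith
  have hψv : ψ z = (‖ψ‖ * ‖z‖ : ℝ) := by
    rw [hval (ψ z) (by nlinarith)]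
    congr 1
    nlinarith
  -- If neither part vanishes, `θ` is the convex combination of the norming functionals `φ/‖φ‖` and
  -- `ψ/‖ψ‖` with weights `‖φ‖` and `‖ψ‖`; extremality identifies them with `θ`.
  have key : ∀ w, φ w = ‖φ‖ * θ w := by
    intro w
    rcases (norm_nonneg φ).eq_or_lt with h | h
    · rw [← h, norm_eq_zero.1 h.symm]; simp
    rcases (norm_nonneg ψ).eq_or_lt with h' | h'
    · rw [← hadd w, norm_eq_zero.1 h'.symm]
      rw [← h', add_zero] at hnormsum
      simp [hnormsum]
    have hmem : ∀ χ : StrongDual ℂ Z, 0 < ‖χ‖ → χ z = (‖χ‖ * ‖z‖ : ℝ) →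
        StrongDual.toWeakDual ((‖χ‖⁻¹ : ℂ) • χ) ∈ normingSet z := by
      intro χ hχ hχz
      constructor
      · change ‖(‖χ‖⁻¹ : ℂ) • χ‖ ≤ 1
        rw [norm_smul, norm_inv, Complex.norm_real, norm_norm]
        exact inv_mul_le_one
      · change (‖χ‖⁻¹ : ℂ) • χ z = ‖z‖
        have : (‖χ‖ : ℂ) ≠ 0 := by exact_mod_cast hχ.ne'
        rw [hχz, smul_eq_mul]
        push_cast
        field_simp
    have heq := (hext _ (hmem φ h hφv) _ (hmem ψ h' hψv)
      ⟨‖φ‖, ‖ψ‖, h, h', hnormsum, ?_⟩).1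
    · have := DFunLike.congr_fun heq w
      change (‖φ‖⁻¹ : ℂ) • φ w = θ w at this
      have h0 : (‖φ‖ : ℂ) ≠ 0 := by exact_mod_cast h.ne'
      rw [← this, smul_eq_mul]
      field_simp
    · refine DFunLike.ext _ _ fun v => ?_
      change (‖φ‖ : ℝ) • ((‖φ‖⁻¹ : ℂ) • φ v) + (‖ψ‖ : ℝ) • ((‖ψ‖⁻¹ : ℂ) • ψ v) = θ v
      have h0 : (‖φ‖ : ℂ) ≠ 0 := by exact_mod_cast h.ne'
      have h0' : (‖ψ‖ : ℂ) ≠ 0 := by exact_mod_cast h'.ne'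
      rw [← hadd v, Complex.real_smul, Complex.real_smul, smul_eq_mul, smul_eq_mul]
      field_simp
  rw [← hφa, ← hφa, key w, hφv]
  push_cast
  ring

theorem exists_character_of_extreme {z : Z} (hz : z ≠ 0) {θ : WeakDual ℂ Z}
    (hθ : θ ∈ (normingSet z).extremePoints ℝ)
    (hC : ∀ c : C, IsSelfAdjoint c → spectrum ℝ c ⊆ Set.Icc 0 1 →
      ‖WeakDual.toStrongDual θ ∘L smulL c‖ + ‖WeakDual.toStrongDual θ ∘L smulL (1 - c)‖ ≤ 1) :
    ∃ t : WeakDual.characterSpace ℂ C, ∀ (c : C) (w : Z), θ (c • w) = t c * θ w := by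
  have hz0 : (‖z‖ : ℂ) ≠ 0 := by simpa using hz
  have hθz : θ z = ‖z‖ := hθ.1.2
  -- The homogeneity relation is linear in `c`, and elements with spectrum in `[0, 1]` together with
  -- `1` span `C`: rescale self-adjoint elements affinely, then split into real and imaginary parts.
  let S : Submodule ℂ C :=
    { carrier := {c | ∀ w, θ (c • w) * ‖z‖ = θ (c • z) * θ w}
      add_mem' := fun {c d} hc hd w => by
        simp only [Set.mem_ofPred_eq] at hc hd
        rw [add_smul, add_smul, map_add, map_add, add_mul, add_mul, hc, hd]
      zero_mem' := fun w => by simp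
      smul_mem' := fun r c hc w => by
        simp only [Set.mem_ofPred_eq] at hc
        rw [smul_assoc, smul_assoc, map_smul θ r, map_smul θ r, smul_mul_assoc, smul_mul_assoc, hc] }
  have hunit : ∀ c : C, IsSelfAdjoint c → spectrum ℝ c ⊆ Set.Icc 0 1 → c ∈ S :=
    fun c hc hs w => extreme_comp_smulL hz hθ (hC c hc hs) w
  have hone : (1 : C) ∈ S := fun w => by simp [hθz, mul_comm]
  have hsa : ∀ c : C, IsSelfAdjoint c → c ∈ S := by
    intro c hc
    -- `‖c‖ ‖1‖` bounds the spectrum without assuming `‖1‖ = 1`; the added `1` keeps `M` positive.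
    set M : ℝ := ‖c‖ * ‖(1 : C)‖ + 1 with hM
    have hM0 : 0 < M := by positivity
    have hcont : ContinuousOn (fun s : ℝ => (2 * M)⁻¹ * (s + M)) (spectrum ℝ c) := by fun_prop
    have h1 : cfc (fun s : ℝ => (2 * M)⁻¹ * (s + M)) c ∈ S := by
      refine hunit _ (cfc_predicate _ _) ?_
      rw [cfc_map_spectrum _ c hc hcont]
      rintro _ ⟨s, hs, rfl⟩
      have hs' := abs_le.1 (spectrum.norm_le_norm_mul_of_mem hs)
      refine ⟨mul_nonneg (by positivity) (by linarith), ?_⟩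
      dsimp only
      rw [mul_comm, ← div_eq_mul_inv, div_le_one (by positivity)]
      linarith
    have h2 : c = ((2 * M : ℝ) : ℂ) • cfc (fun s : ℝ => (2 * M)⁻¹ * (s + M)) c - (M : ℂ) • 1 := by
      have h3 : cfc (fun s : ℝ => (2 * M)⁻¹ * (s + M)) c = (2 * M)⁻¹ • (c + algebraMap ℝ C M) := by
        rw [cfc_const_mul _ _ c, cfc_add_const _ _ c, cfc_id' ℝ c]
      rw [h3, Complex.coe_smul, smul_smul, mul_inv_cancel₀ (by positivity), one_smul,
        Complex.coe_smul, ← Algebra.algebraMap_eq_smul_one, add_sub_cancel_right]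
    rw [h2]
    exact S.sub_mem (S.smul_mem _ h1) (S.smul_mem _ hone)
  have htop : ∀ c : C, c ∈ S := by
    intro c
    rw [← realPart_add_I_smul_imaginaryPart c]
    exact S.add_mem (hsa _ (realPart c).2) (S.smul_mem _ (hsa _ (imaginaryPart c).2))
  have hmul : ∀ (c : C) (w : Z), θ (c • w) = θ (c • z) / ‖z‖ * θ w := by
    intro c w
    rw [div_mul_eq_mul_div, eq_div_iff hz0]
    exact htop c w
  let f : C →ₗ[ℂ] ℂ :=
    { toFun := fun c => θ (c • z) / ‖z‖
      map_add' := fun c d => by rw [add_smul, map_add, add_div]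
      map_smul' := fun r c => by
        rw [smul_assoc, map_smul θ r, RingHom.id_apply, smul_eq_mul, smul_eq_mul, mul_div_assoc] }
  -- Multiplicativity is the homogeneity relation evaluated at `w = d z`.
  let t : C →ₐ[ℂ] ℂ := AlgHom.ofLinearMap f
    (by change θ ((1 : C) • z) / ‖z‖ = 1; rw [one_smul, hθz, div_self hz0])
    (fun c d => by
      change θ ((c * d) • z) / ‖z‖ = θ (c • z) / ‖z‖ * (θ (d • z) / ‖z‖)
      rw [mul_smul, hmul c (d • z), mul_div_assoc])
  exact ⟨WeakDual.CharacterSpace.equivAlgHom.symm t, hmul⟩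

end ExtremeFunctionals

/-! ### Diagonal operators -/

section Diagonal

variable {ι : Type*}

/-- The diagonal operator on `ℓ²` with bounded diagonal `g`. -/
def diagOp (g : ι → ℂ) {M : ℝ} (hM : 0 ≤ M) (hg : ∀ i, ‖g i‖ ≤ M) :
    lp (fun _ : ι => ℂ) 2 →L[ℂ] lp (fun _ : ι => ℂ) 2 :=
  lp.mapCLM 2 (fun i => g i • ContinuousLinearMap.id ℂ ℂ) hM fun i => by simpa [norm_smul] using hg i

theorem diagOp_apply (g : ι → ℂ) {M : ℝ} (hM : 0 ≤ M) (hg : ∀ i, ‖g i‖ ≤ M)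
    (f : lp (fun _ : ι => ℂ) 2) (i : ι) : diagOp g hM hg f i = g i * f i := rfl

theorem norm_diagOp_le (g : ι → ℂ) {M : ℝ} (hM : 0 ≤ M) (hg : ∀ i, ‖g i‖ ≤ M) :
    ‖diagOp g hM hg‖ ≤ M :=
  lp.norm_mapCLM_le _ _ _ _

theorem norm_apply_le_norm_diagOp (g : ι → ℂ) {M : ℝ} (hM : 0 ≤ M) (hg : ∀ i, ‖g i‖ ≤ M) (i : ι) :
    ‖g i‖ ≤ ‖diagOp g hM hg‖ := by
  classical
  have h1 := (diagOp g hM hg).le_opNorm (lp.single 2 i 1)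
  rw [lp.norm_single (by norm_num), norm_one, mul_one] at h1
  have h2 := lp.norm_apply_le_norm (by norm_num) (diagOp g hM hg (lp.single 2 i 1)) i
  rw [diagOp_apply, lp.single_apply_self, mul_one] at h2
  exact h2.trans h1

/-- A family of characters acts diagonally on `ℓ²`. -/
def diagRep {C : Type*} [CommCStarAlgebra C] (t : ι → WeakDual.characterSpace ℂ C) :
    C →⋆ₐ[ℂ] (lp (fun _ : ι => ℂ) 2 →L[ℂ] lp (fun _ : ι => ℂ) 2) where
  toFun c := diagOp (fun i => t i c) (norm_nonneg c) fun i =>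
    NonUnitalStarAlgHom.norm_apply_le (t i) c
  map_one' := by ext f i; simp [diagOp_apply]
  map_mul' c d := by ext f i; simp [diagOp_apply, mul_assoc]
  map_zero' := by ext f i; simp [diagOp_apply]
  map_add' c d := by ext f i; simp [diagOp_apply, add_mul]
  commutes' r := by
    ext f i
    simp [diagOp_apply, Algebra.algebraMap_eq_smul_one]
  map_star' c := by
    rw [ContinuousLinearMap.star_eq_adjoint, ContinuousLinearMap.eq_adjoint_iff]
    intro f g
    rw [lp.inner_eq_tsum, lp.inner_eq_tsum]
    refine tsum_congr fun i => ?_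
    simp only [diagOp_apply, map_star, RCLike.inner_apply, map_mul, RCLike.star_def,
      Complex.conj_conj]
    ring

theorem diagRep_apply {C : Type*} [CommCStarAlgebra C] (t : ι → WeakDual.characterSpace ℂ C) (c : C)
    (f : lp (fun _ : ι => ℂ) 2) (i : ι) : diagRep t c f i = t i c * f i := rfl

/-- A central bimodule is representable if it is normed by functionals that are
homogeneous for characters. -/
theorem IsRepresentable.of_norming {C : Type uC} {Z : Type uX} [CommCStarAlgebra C]
    [NormedAddCommGroup Z] [NormedSpace ℂ Z] [Module C Z] [Module Cᵐᵒᵖ Z] [IsCentralScalar C Z]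
    (h : ∀ z : Z, z ≠ 0 → ∃ (t : WeakDual.characterSpace ℂ C) (θ : StrongDual ℂ Z), ‖θ‖ ≤ 1 ∧
      θ z = ‖z‖ ∧ ∀ (c : C) (w : Z), θ (c • w) = t c * θ w) :
    IsRepresentable.{max uC uX} C C Z := by
  -- Indexing by all admissible pairs makes `Φ` isometric, since some index norms each nonzero `z`.
  -- Diagonal operators commute, so one representation serves on both sides.
  let I := {p : WeakDual.characterSpace ℂ C × StrongDual ℂ Z //
    ‖p.2‖ ≤ 1 ∧ ∀ (c : C) (w : Z), p.2 (c • w) = p.1 c * p.2 w}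
  have hI : ∀ (z : Z) (i : I), ‖i.1.2 z‖ ≤ ‖z‖ := fun z i =>
    (i.1.2.le_opNorm z).trans (mul_le_of_le_one_left (norm_nonneg z) i.2.1)
  let Φ : Z →ₗ[ℂ] (lp (fun _ : I => ℂ) 2 →L[ℂ] lp (fun _ : I => ℂ) 2) :=
    { toFun := fun z => diagOp (fun i : I => i.1.2 z) (norm_nonneg z) (hI z)
      map_add' := fun z w => by ext f i; simp [diagOp_apply, add_mul]
      map_smul' := fun r z => by ext f i; simp [diagOp_apply, mul_assoc] }
  have hΦ : ∀ z f (i : I), Φ z f i = i.1.2 z * f i := fun z f i => rfl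
  have hnorm : ∀ z, ‖Φ z‖ = ‖z‖ := by
    intro z
    refine le_antisymm (norm_diagOp_le _ (norm_nonneg z) (hI z)) ?_
    rcases eq_or_ne z 0 with rfl | hz
    · rw [norm_zero]; exact norm_nonneg _
    obtain ⟨t, θ, hθ, hz', hc⟩ := h z hz
    have := norm_apply_le_norm_diagOp (fun i : I => i.1.2 z) (norm_nonneg z) (hI z)
      ⟨(t, θ), hθ, hc⟩
    simp only [hz', Complex.norm_real, norm_norm] at this
    exact this
  refine ⟨lp (fun _ : I => ℂ) 2, inferInstance, inferInstance, inferInstance,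
    lp (fun _ : I => ℂ) 2, inferInstance, inferInstance, inferInstance,
    diagRep fun i : I => i.1.1, diagRep fun i : I => i.1.1, ⟨Φ, hnorm⟩, fun c z => ?_,
    fun c z => ?_⟩
  · ext f i
    change Φ (c • z) f i = diagRep (fun i : I => i.1.1) c (Φ z f) i
    rw [hΦ, diagRep_apply, hΦ, i.2.2, mul_assoc]
  · ext f i
    change Φ (MulOpposite.op c • z) f i = Φ z (diagRep (fun i : I => i.1.1) c f) i
    rw [hΦ, hΦ, diagRep_apply, op_smul_eq_smul, i.2.2]
    ring

end Diagonal

/-! ### Functionals that factor through a fibre -/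

section Factor

variable {C X Y : Type*} [CommCStarAlgebra C]
  [NormedAddCommGroup X] [NormedSpace ℂ X] [Module C X] [Module Cᵐᵒᵖ X] [IsScalarTower ℂ C X]
  [IsBoundedSMul C X] [IsCentralScalar C X]
  [NormedAddCommGroup Y] [NormedSpace ℂ Y] [Module C Y] [Module Cᵐᵒᵖ Y] [IsScalarTower ℂ C Y]
  [IsBoundedSMul C Y] [IsCentralScalar C Y]

/-- The bilinear form `(x, y) ↦ θ (x ⊗_C y)`. -/
def formOf (θ : StrongDual ℂ (ModTensor C X Y)) : X →L[ℂ] Y →L[ℂ] ℂ :=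
  LinearMap.mkContinuous₂
    (LinearMap.mk₂ ℂ (fun x y => θ (mtmul C x y))
      (fun x x' y => by rw [mtmul_add_left, map_add])
      (fun r x y => by rw [mtmul_smul_left, map_smul])
      (fun x y y' => by rw [mtmul_add, map_add])
      (fun r x y => by rw [mtmul, ptmul_smul, map_smul, map_smul]; rfl)) ‖θ‖
    fun x y => by
      rw [mul_assoc]
      exact (θ.le_opNorm _).trans (mul_le_mul_of_nonneg_left (norm_mtmul_le x y) (norm_nonneg _))

theorem formOf_apply (θ : StrongDual ℂ (ModTensor C X Y)) (x : X) (y : Y) :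
    formOf θ x y = θ (mtmul C x y) := rfl

theorem fiberKer_le_ker {X E : Type*} [NormedAddCommGroup X] [NormedSpace ℂ X] [Module C X]
    [NormedAddCommGroup E] [NormedSpace ℂ E] {t : WeakDual.characterSpace ℂ C} (f : X →L[ℂ] E)
    (hf : ∀ (c : C) (x : X), t c = 0 → f (c • x) = 0) : fiberKer C X t ≤ f.ker := by
  refine Submodule.topologicalClosure_minimal _ (Submodule.span_le.2 ?_) f.isClosed_ker
  rintro _ ⟨c, x, hc, rfl⟩
  exact hf c x hc

/-- The bilinear form on `X(t) × Y(t)` induced by a functional that is homogeneous for `t`. -/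
def fiberForm {t : WeakDual.characterSpace ℂ C} (θ : StrongDual ℂ (ModTensor C X Y))
    (hθ : ∀ (c : C) (w : ModTensor C X Y), θ (c • w) = t c * θ w) :
    Fiber C X t →ₗ[ℂ] Fiber C Y t →ₗ[ℂ] ℂ :=
  -- Descend in `Y` first, on the flipped form, then in `X`. Both kernel conditions hold because `c`
  -- can be pulled out of either factor as `t c = 0`.
  (fiberKer C X t).liftQ ((fiberKer C Y t).liftQ (formOf θ).toLinearMap₁₂.flip
    fun y hy => LinearMap.mem_ker.2 <| LinearMap.ext fun x =>
      fiberKer_le_ker (t := t) (formOf θ x)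
        (fun c y hc => by rw [formOf_apply, mtmul_smul, hθ, hc, zero_mul]) hy).flip
    fun x hx => LinearMap.mem_ker.2 <| LinearMap.ext fun η => by
      obtain ⟨y, rfl⟩ := Submodule.mkQ_surjective _ η
      exact fiberKer_le_ker (t := t) ((formOf θ).flip y)
        (fun c x hc => by
          rw [ContinuousLinearMap.flip_apply, formOf_apply, ← smul_mtmul, hθ, hc, zero_mul]) hx

theorem norm_fiberForm_le {t : WeakDual.characterSpace ℂ C} (θ : StrongDual ℂ (ModTensor C X Y))
    (hθ : ∀ (c : C) (w : ModTensor C X Y), θ (c • w) = t c * θ w) (h1 : ‖θ‖ ≤ 1)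
    (ξ : Fiber C X t) (η : Fiber C Y t) : ‖fiberForm θ hθ ξ η‖ ≤ ‖ξ‖ * ‖η‖ := by
  -- The quotient norms need not be attained, so lift to representatives within `ε`.
  have key : ∀ ε > 0, ‖fiberForm θ hθ ξ η‖ ≤ (‖ξ‖ + ε) * (‖η‖ + ε) := by
    intro ε hε
    obtain ⟨x, rfl, hx⟩ := Submodule.Quotient.norm_mk_lt (S := fiberKer C X t) ξ hε
    obtain ⟨y, rfl, hy⟩ := Submodule.Quotient.norm_mk_lt (S := fiberKer C Y t) η hε
    change ‖θ (mtmul C x y)‖ ≤ _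
    calc ‖θ (mtmul C x y)‖ ≤ 1 * ‖mtmul C x y‖ := θ.le_of_opNorm_le h1 _
      _ ≤ ‖x‖ * ‖y‖ := by rw [one_mul]; exact norm_mtmul_le x y
      _ ≤ _ := mul_le_mul hx.le hy.le (norm_nonneg _) (by positivity)
  have hlim : Filter.Tendsto (fun ε : ℝ => (‖ξ‖ + ε) * (‖η‖ + ε)) (nhdsWithin 0 (Set.Ioi 0))
      (nhds (‖ξ‖ * ‖η‖)) := by
    have : Continuous fun ε : ℝ => (‖ξ‖ + ε) * (‖η‖ + ε) := by fun_prop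
    have h := this.tendsto 0
    simp only [add_zero] at h
    exact h.mono_left nhdsWithin_le_nhds
  exact ge_of_tendsto hlim (Filter.eventually_of_mem self_mem_nhdsWithin key)

/-- On algebraic tensors `θ` is the linearised fibre form composed with `x ⊗ y ↦ x(t) ⊗ y(t)`, and a
form of norm at most `1` is dominated by the projective norm. -/
theorem norm_apply_le_norm_kappaAt {t : WeakDual.characterSpace ℂ C}
    (θ : StrongDual ℂ (ModTensor C X Y))
    (hθ : ∀ (c : C) (w : ModTensor C X Y), θ (c • w) = t c * θ w) (h1 : ‖θ‖ ≤ 1)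
    (z : ModTensor C X Y) : ‖θ z‖ ≤ ‖kappaAt t z‖ := by
  obtain ⟨w, rfl⟩ := Submodule.mkQ_surjective (balancedKer C X Y) z
  change ‖θ (modMk C X Y w)‖ ≤ ‖ptmap (toFiber C t) (toFiber C t) w‖
  induction w using UniformSpace.Completion.induction_on with
  | hp => exact isClosed_le (by fun_prop) (by fun_prop)
  | ih w =>
    have hB : ∀ w : AlgTensor X Y, θ (modMk C X Y (w : ProjTensor X Y)) = TensorProduct.lift (fiberForm θ hθ)
        (TensorProduct.map (toFiber C (X := X) t).toLinearMap (toFiber C (X := Y) t).toLinearMap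
          w) := fun w =>
      LinearMap.congr_fun (TensorProduct.ext' (R := ℂ) (M := X) (N := Y)
        (g := (θ ∘L modMk C X Y ∘L UniformSpace.Completion.toComplL).toLinearMap)
        (h := TensorProduct.lift (fiberForm θ hθ) ∘ₗ TensorProduct.map (toFiber C (X := X) t).toLinearMap
          (toFiber C (X := Y) t).toLinearMap) fun x y => rfl) w
    unfold ptmap
    rw [hB, ContinuousLinearMap.completion_apply_coe, UniformSpace.Completion.norm_coe]
    -- The infimum runs over all representations in `X(t) ⊗ Y(t)`, including those not induced from
    -- `X ⊗ Y`; hence the need for a bound on arbitrary cosets.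
    refine le_csInf (projCosts_nonempty _) ?_
    rintro r ⟨n, x, y, hw, rfl⟩
    have hsum := (congrArg (TensorProduct.lift (fiberForm θ hθ)) hw).trans (map_sum _ _ _)
    refine (congrArg norm hsum).trans_le ?_
    exact (norm_sum_le _ _).trans (Finset.sum_le_sum fun i _ => by
      rw [TensorProduct.lift.tmul]
      exact norm_fiberForm_le θ hθ h1 _ _)

theorem exists_norming_functional (hX : IsRepresentable.{w₁} C C X)
    (hY : IsRepresentable.{w₂} C C Y) {z : ModTensor C X Y} (hz : z ≠ 0) :
    ∃ (t : WeakDual.characterSpace ℂ C) (θ : StrongDual ℂ (ModTensor C X Y)), ‖θ‖ ≤ 1 ∧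
      θ z = ‖z‖ ∧ ∀ (c : C) (w : ModTensor C X Y), θ (c • w) = t c * θ w := by
  obtain ⟨θ, hθ⟩ := extremePoints_normingSet_nonempty hz
  obtain ⟨t, ht⟩ := exists_character_of_extreme (C := C) hz hθ fun c hc hs =>
    norm_comp_smulL_add_le hX hY hc hs hθ.1.1
  exact ⟨t, WeakDual.toStrongDual θ, hθ.1.1, hθ.1.2, ht⟩

end Factor

end CentralBimodule

end

/-! ### The isometry and the representation -/

theorem mainTheorem4
    (C : Type uC) [CommCStarAlgebra C]
    (X : Type uX) [NormedAddCommGroup X] [NormedSpace ℂ X] [CompleteSpace X]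
    [Module C X] [Module Cᵐᵒᵖ X] [IsScalarTower ℂ C X] [IsBoundedSMul C X] [IsCentralScalar C X]
    (Y : Type uY) [NormedAddCommGroup Y] [NormedSpace ℂ Y] [CompleteSpace Y]
    [Module C Y] [Module Cᵐᵒᵖ Y] [IsScalarTower ℂ C Y] [IsBoundedSMul C Y] [IsCentralScalar C Y]
    (hX : CentralBimodule.IsRepresentable.{w₁} C C X)
    (hY : CentralBimodule.IsRepresentable.{w₂} C C Y) :
    Isometry (CentralBimodule.kappa C X Y) ∧
      CentralBimodule.IsRepresentable.{max uC uX uY} C C (CentralBimodule.ModTensor C X Y) := by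
  refine ⟨AddMonoidHomClass.isometry_of_norm _ fun z => le_antisymm ?_ ?_,
    CentralBimodule.IsRepresentable.of_norming fun z hz =>
      CentralBimodule.exists_norming_functional hX hY hz⟩
  · exact lp.norm_le_of_forall_le (norm_nonneg z) fun t => CentralBimodule.norm_kappaAt_le t z
  · rcases eq_or_ne z 0 with rfl | hz
    · rw [norm_zero]
      exact norm_nonneg _
    -- The single coordinate `t` of the norming functional already carries the full norm of `z`.
    obtain ⟨t, θ, hθ, hθz, ht⟩ := CentralBimodule.exists_norming_functional hX hY hz
    have h := CentralBimodule.norm_apply_le_norm_kappaAt θ ht hθ z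
    rw [hθz, Complex.norm_real, norm_norm] at h
    exact h.trans (lp.norm_apply_le_norm ENNReal.top_ne_zero (CentralBimodule.kappa C X Y z) t)
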